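/- Let $m\ge 5$ be an odd integer, let $e$ be a positive integer with $\gcd(m,e)=1$, put $q=2^m$, and let $\mathrm{Tr}$ denote the trace from $\mathrm{GF}(q)$ to $\mathrm{GF}(2)$. Let $$\mathcal C=\left\{\left(\mathrm{Tr}\left(a x^{2^e+1}+bx+c\right)\right)_{x\in \mathrm{GF}(q)} : a,b,c\in \mathrm{GF}(q)\right\},$$ a binary linear code of length $q$ whose coordinate positions are the elements of $\mathrm{GF}(q)$. Let $T=\{x_1,x_2,x_3,x_4\}$ be a $4$-subset of $\mathrm{GF}(q)$, and let $\mathcal C_T$ be the shortened code of $\mathcal C$ on $T$, that is, the code obtained from the subcode of all codewords of $\mathcal C$ vanishing on $T$ by deleting the coordinates in $T$. Then $\mathcal C_T$ is a $[2^m-4,\ 2m-3,\ 2^{m-1}-2^{(m-1)/2}]$ binary linear code (length, dimension, minimum Hamming distance). Let $A_w$ be the number of codewords of Hamming weight $w$ in $\mathcal C_T$. Then $A_0=1$, and $A_w=0$ for every $w\notin\{0,\ 2^{m-1}-2^{(m-1)/2},\ 2^{m-1},\ 2^{m-1}+2^{(m-1)/2}\}$. Moreover: (1) If $\sum_{i=1}^4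 x_i\neq 0$ and $\mathrm{Tr}\left(\frac{\sum_{i=1}^4 x_i^{2^e+1}}{\left(\sum_{i=1}^4 x_i\right)^{2^e+1}}\right)=1$, then $$A_{2^{m-1}-2^{(m-1)/2}}=3\cdot 2^{m-4}-2^{(m-3)/2}+2^{2m-5}+2^{(3m-5)/2},$$ $$A_{2^{m-1}}=2^{-4}(2^m-8)(2^m+2),$$ $$A_{2^{m-1}+2^{(m-1)/2}}=3\cdot 2^{m-4}+2^{(m-3)/2}+2^{2m-5}-2^{(3m-5)/2}.$$ (2) Otherwise, $$A_{2^{m-1}-2^{(m-1)/2}}=-2^{(m-3)/2}+2^{m-3}+2^{2m-5}+2^{(3m-5)/2},$$ $$A_{2^{m-1}}=-1-2^{m-2}+4^{m-2},$$ $$A_{2^{m-1}+2^{(m-1)/2}}=2^{(m-3)/2}+2^{m-3}+2^{2m-5}-2^{(3m-5)/2}.$$ -/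

import Mathlib

/-- The linear code `{(Tr(a f(x) + b x + c))_{x ∈ F} : a, b, c ∈ F}` over `ZMod p`, whose
coordinate positions are the elements of the field `F`. -/
noncomputable def traceCode (p : ℕ) [Fact p.Prime] (F : Type*) [Field F] [Algebra (ZMod p) F]
    (f : F → F) : Submodule (ZMod p) (F → ZMod p) where
  carrier := {u | ∃ a b c : F, u = fun x => Algebra.trace (ZMod p) F (a * f x + b * x + c)}
  zero_mem' := ⟨0, 0, 0, by funext x; simp⟩
  add_mem' := by
    rintro _ _ ⟨a, b, c, rfl⟩ ⟨a', b', c', rfl⟩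
    refine ⟨a + a', b + b', c + c', ?_⟩
    funext x
    rw [Pi.add_apply, ← map_add]
    congr 1
    ring
  smul_mem' := by
    rintro k _ ⟨a, b, c, rfl⟩
    refine ⟨k • a, k • b, k • c, ?_⟩
    funext x
    rw [Pi.smul_apply, ← map_smul]
    congr 1
    simp only [smul_add, smul_mul_assoc]

/-- The subcode of the codewords that vanish on the set `T` of coordinate positions. -/
def vanishingSubcode {K ι : Type*} [Field K] (C : Submodule K (ι → K)) (T : Finset ι) :
    Submodule K (ι → K) where
  carrier := {u | u ∈ C ∧ ∀ i ∈ T, u i = 0}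
  zero_mem' := ⟨C.zero_mem, fun _ _ => rfl⟩
  add_mem' := fun hu hv => ⟨C.add_mem hu.1 hv.1, fun i hi => by simp [hu.2 i hi, hv.2 i hi]⟩
  smul_mem' := fun k _ hu => ⟨C.smul_mem k hu.1, fun i hi => by simp [hu.2 i hi]⟩

/-- The punctured code: delete the coordinates in `T` from every codeword. -/
def puncturedCode {K ι : Type*} [Field K] (C : Submodule K (ι → K)) (T : Finset ι) :
    Submodule K ({i : ι // i ∉ T} → K) :=
  C.map (LinearMap.funLeft K K (Subtype.val : {i : ι // i ∉ T} → ι))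

/-- The shortened code: take the codewords that vanish on `T`, then puncture on `T`. -/
def shortenedCode {K ι : Type*} [Field K] (C : Submodule K (ι → K)) (T : Finset ι) :
    Submodule K ({i : ι // i ∉ T} → K) :=
  puncturedCode (vanishingSubcode C T) T

/-- `C` is an `[n, k, d]` linear code: length `n`, dimension `k`, minimum Hamming distance `d`. -/
structure IsLinearCode {K ι : Type*} [Field K] [DecidableEq K] [Fintype ι]
    (C : Submodule K (ι → K)) (n k d : ℕ) : Prop where
  length_eq : Fintype.card ι = n
  finrank_eq : Module.finrank K C = k
  minDist_eq : IsLeast {r : ℕ | ∃ u ∈ C, ∃ v ∈ C, u ≠ v ∧ hammingDist u v = r} d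

/-- The number of codewords of Hamming weight `w`. -/
noncomputable def weightCount {K ι : Type*} [Field K] [DecidableEq K] [Fintype ι]
    (C : Submodule K (ι → K)) (w : ℕ) : ℕ :=
  Set.ncard {u : ι → K | u ∈ C ∧ hammingNorm u = w}

/-- The weight distribution
`A_0 = 1`,
`A_{2^(m-1) - 2^((m-1)/2)} = -2^((m-3)/2) + 2^(m-3) + 2^(2m-5) + 2^((3m-5)/2)`,
`A_{2^(m-1)} = -1 - 2^(m-2) + 4^(m-2)`,
`A_{2^(m-1) + 2^((m-1)/2)} = 2^((m-3)/2) + 2^(m-3) + 2^(2m-5) - 2^((3m-5)/2)`,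
all other `A_w` being zero. It is used only for odd `m ≥ 5`, where every subtraction and division
of natural numbers below is exact. -/
def weightTableA (m w : ℕ) : ℚ :=
  if w = 0 then 1
  else if w = 2 ^ (m - 1) - 2 ^ ((m - 1) / 2) then
    -2 ^ ((m - 3) / 2) + 2 ^ (m - 3) + 2 ^ (2 * m - 5) + 2 ^ ((3 * m - 5) / 2)
  else if w = 2 ^ (m - 1) then -1 - 2 ^ (m - 2) + 4 ^ (m - 2)
  else if w = 2 ^ (m - 1) + 2 ^ ((m - 1) / 2) then
    2 ^ ((m - 3) / 2) + 2 ^ (m - 3) + 2 ^ (2 * m - 5) - 2 ^ ((3 * m - 5) / 2)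
  else 0

/-- The weight distribution
`A_0 = 1`,
`A_{2^(m-1) - 2^((m-1)/2)} = 3 * 2^(m-4) - 2^((m-3)/2) + 2^(2m-5) + 2^((3m-5)/2)`,
`A_{2^(m-1)} = (2^m - 8) (2^m + 2) / 16`,
`A_{2^(m-1) + 2^((m-1)/2)} = 3 * 2^(m-4) + 2^((m-3)/2) + 2^(2m-5) - 2^((3m-5)/2)`,
all other `A_w` being zero. It is used only for odd `m ≥ 5`, where every subtraction and division
of natural numbers below is exact. -/
def weightTableB (m w : ℕ) : ℚ :=
  if w = 0 then 1
  else if w = 2 ^ (m - 1) - 2 ^ ((m - 1) / 2) then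
    3 * 2 ^ (m - 4) - 2 ^ ((m - 3) / 2) + 2 ^ (2 * m - 5) + 2 ^ ((3 * m - 5) / 2)
  else if w = 2 ^ (m - 1) then (2 ^ m - 8) * (2 ^ m + 2) / 16
  else if w = 2 ^ (m - 1) + 2 ^ ((m - 1) / 2) then
    3 * 2 ^ (m - 4) + 2 ^ ((m - 3) / 2) + 2 ^ (2 * m - 5) - 2 ^ ((3 * m - 5) / 2)
  else 0

/-! Only the bit `Tr c` of `c` matters, so codewords are parametrized by triples `p = (a, b, t)`.
Put `W(p) = ∑ x, (-1)^(word p x) = q - 2 * weight`. For a nonzero triple whose word vanishes on `T`,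
`W(p)` is `0` or `±2^((m+1)/2)`: for `a ≠ 0` this is the Walsh spectrum of the Gold function
(`sq_gold_walsh`), and for `a = 0` the word is balanced. Only three weight multiplicities remain
unknown, and the moments of order 0, 1, 2 of `W` determine them.

To restrict a moment to words vanishing on `T`, write the indicator of vanishing as the average over
`S ⊆ T` of `(-1)^(∑ t ∈ S, word p t)`. Orthogonality of characters then turns each moment into a
count of additive relations between points `(x, x^(2^e+1), 1)` (`sum_vanishingTriples`). The APN
property (`gold_pow_apn`) leaves only the trivial relations, with one exception: in the second
moment, `S = T` contributes the number of ordered pairs with the same two sums as `T`. That number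
is `2` or `0`, as decided by the trace condition (`card_gold_pairs`, `goldPairCount_four`), whence
the two weight tables. -/

/-! ### Signs of elements of `ZMod 2` -/

/-- The sign `(-1) ^ t` of `t : ZMod 2`. -/
def zmodTwoSign (t : ZMod 2) : ℤ := if t = 0 then 1 else -1

@[simp] theorem zmodTwoSign_zero : zmodTwoSign 0 = 1 := rfl

@[simp] theorem zmodTwoSign_one : zmodTwoSign 1 = -1 := rfl

theorem zmodTwoSign_add : ∀ s t : ZMod 2, zmodTwoSign (s + t) = zmodTwoSign s * zmodTwoSign t := by
  decide

theorem zmodTwoSign_mul_self : ∀ t : ZMod 2, zmodTwoSign t * zmodTwoSign t = 1 := by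
  decide

theorem zmodTwoSign_sum {ι : Type*} (S : Finset ι) (f : ι → ZMod 2) :
    zmodTwoSign (∑ i ∈ S, f i) = ∏ i ∈ S, zmodTwoSign (f i) := by
  classical
  induction S using Finset.induction_on with
  | empty => simp
  | insert a S ha ih => rw [Finset.sum_insert ha, Finset.prod_insert ha, zmodTwoSign_add, ih]

theorem ZMod.two_eq_zero_or_one : ∀ t : ZMod 2, t = 0 ∨ t = 1 := by decide

/-- A nonzero additive map to `ZMod 2` is balanced. -/
theorem sum_zmodTwoSign_eq_zero {G : Type*} [AddCommGroup G] [Fintype G] (f : G →+ ZMod 2) (g : G)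
    (hg : f g ≠ 0) : ∑ x, zmodTwoSign (f x) = 0 := by
  have hg1 : f g = 1 := (ZMod.two_eq_zero_or_one _).resolve_left hg
  -- Translation by `g` flips every sign, so the sum equals its own negative.
  have h := Equiv.sum_comp (Equiv.addRight g) (fun x => zmodTwoSign (f x))
  simp only [Equiv.coe_addRight, map_add, zmodTwoSign_add, hg1, zmodTwoSign_one, mul_neg, mul_one,
    Finset.sum_neg_distrib] at h
  omega

/-- The sum is the expansion of `∏ t ∈ T, (1 + (-1)^(u t))`, in which one nonzero `u t` kills the
product. This is the indicator used to restrict moments to the words vanishing on `T`. -/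
theorem sum_prod_one_add_zmodTwoSign {ι : Type*} [DecidableEq ι] (T : Finset ι) (u : ι → ZMod 2) :
    ∑ S ∈ T.powerset, zmodTwoSign (∑ t ∈ S, u t) = if ∀ t ∈ T, u t = 0 then 2 ^ T.card else 0 := by
  simp_rw [zmodTwoSign_sum]
  rw [← Finset.prod_one_add]
  split_ifs with h
  · rw [Finset.prod_congr rfl (g := fun _ => (2 : ℤ)) (fun t ht => by rw [h t ht]; rfl)]
    simp
  · push Not at h
    obtain ⟨t, ht, h0⟩ := h
    refine Finset.prod_eq_zero ht ?_
    rw [(ZMod.two_eq_zero_or_one _).resolve_left h0]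
    rfl

/-! ### Arithmetic of the Gold power map: APN property and Walsh spectrum -/

section Field

/-- A power of Frobenius prime to the degree of `F` fixes only the prime field. -/
theorem eq_zero_or_one_of_pow_eq_self {F : Type*} [Field F] [Fintype F] {m e : ℕ} (hF : Fintype.card F = 2 ^ m)
    (hme : Nat.gcd m e = 1) {t : F} (ht : t ^ 2 ^ e = t) : t = 0 ∨ t = 1 := by
  have h1 : Function.IsPeriodicPt (fun x : F => x ^ 2) m t := by
    rw [Function.IsPeriodicPt, Function.IsFixedPt, pow_iterate, ← hF]
    exact FiniteField.pow_card t
  have h2 : Function.IsPeriodicPt (fun x : F => x ^ 2) e t := by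
    rw [Function.IsPeriodicPt, Function.IsFixedPt, pow_iterate]
    exact ht
  have h3 := h1.gcd h2
  rw [hme] at h3
  have h4 : t ^ 2 = t := h3
  have h5 : t * (t - 1) = 0 := by linear_combination h4
  exact (mul_eq_zero.mp h5).imp id sub_eq_zero.mp

/-- If two nonzero elements have the same image, their ratio `r` satisfies `r^(2^e) = r⁻¹`, so it is
fixed by the `2e`-th power of Frobenius. Oddness of `m` gives `gcd(m, 2e) = 1`, hence `r = 1`. -/
theorem gold_pow_bijective {F : Type*} [Field F] [Fintype F] {m e : ℕ} (hF : Fintype.card F = 2 ^ m) (hme : Nat.gcd m e = 1)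
    (hmodd : Odd m) : Function.Bijective (fun x : F => x ^ (2 ^ e + 1)) := by
  rw [← Finite.injective_iff_bijective]
  intro x y hxy
  simp only at hxy
  by_cases hy : y = 0
  · subst hy
    rw [zero_pow (Nat.succ_ne_zero _)] at hxy
    exact pow_eq_zero_iff (Nat.succ_ne_zero _) |>.mp hxy
  have h1 : (x / y) ^ (2 ^ e + 1) = 1 := by
    rw [div_pow, hxy, div_self (pow_ne_zero _ hy)]
  have h0 : x / y ≠ 0 := fun h => by
    rw [h, zero_pow (Nat.succ_ne_zero _)] at h1
    exact zero_ne_one h1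
  have h2 : (x / y) ^ 2 ^ (2 * e) = x / y := by
    have h3 : (x / y) ^ 2 ^ e * (x / y) = 1 := by rw [← pow_succ, h1]
    have h4 : (x / y) ^ 2 ^ (2 * e) * (x / y) ^ 2 ^ e = 1 := by
      rw [two_mul, pow_add, pow_mul, ← mul_pow, h3, one_pow]
    refine mul_right_cancel₀ (pow_ne_zero (2 ^ e) h0) ?_
    rw [h4, mul_comm, h3]
  have h5 : Nat.gcd m (2 * e) = 1 :=
    Nat.Coprime.mul_right (Nat.coprime_two_right.mpr hmodd) hme
  exact (div_eq_one_iff_eq hy).mp ((eq_zero_or_one_of_pow_eq_self hF h5 h2).resolve_left h0)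

variable {F : Type*} [Field F] [Algebra (ZMod 2) F]

theorem pow_two_pow_add (e : ℕ) (x y : F) : (x + y) ^ 2 ^ e = x ^ 2 ^ e + y ^ 2 ^ e := by
  have : CharP F 2 := charP_of_injective_algebraMap (algebraMap (ZMod 2) F).injective 2
  exact add_pow_char_pow x y 2 e

theorem add_self_eq_zero_of_algebra_zmod_two (x : F) : x + x = 0 := by
  have : CharP F 2 := charP_of_injective_algebraMap (algebraMap (ZMod 2) F).injective 2
  exact CharTwo.add_self_eq_zero x

theorem add_eq_zero_iff_of_algebra_zmod_two (x y : F) : x + y = 0 ↔ x = y := by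
  have : CharP F 2 := charP_of_injective_algebraMap (algebraMap (ZMod 2) F).injective 2
  exact CharTwo.add_eq_zero

theorem gold_pow_add (e : ℕ) (x y : F) :
    (x + y) ^ (2 ^ e + 1) =
      x ^ (2 ^ e + 1) + y ^ (2 ^ e + 1) + (x ^ 2 ^ e * y + x * y ^ 2 ^ e) := by
  rw [pow_succ, pow_two_pow_add]
  ring

variable [Fintype F]

theorem pow_two_pow_bijective (e : ℕ) : Function.Bijective (fun z : F => z ^ 2 ^ e) := by
  rw [← Finite.injective_iff_bijective]
  intro x y hxy
  simp only at hxy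
  have h : (x + y) ^ 2 ^ e = 0 := by rw [pow_two_pow_add, hxy, add_self_eq_zero_of_algebra_zmod_two]
  exact (add_eq_zero_iff_of_algebra_zmod_two _ _).mp
    ((pow_eq_zero_iff (pow_ne_zero _ two_ne_zero)).mp h)

theorem trace_pow_two_pow (e : ℕ) (x : F) :
    Algebra.trace (ZMod 2) F (x ^ 2 ^ e) = Algebra.trace (ZMod 2) F x := by
  induction e with
  | zero => simp
  | succ e ih =>
    rw [pow_succ, pow_mul, ← ih]
    have h := Algebra.trace_eq_of_algEquiv (FiniteField.frobeniusAlgEquivOfAlgebraic (ZMod 2) F)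
      (x ^ 2 ^ e)
    simpa using h

theorem exists_trace_mul_ne_zero {c : F} (hc : c ≠ 0) :
    ∃ x, Algebra.trace (ZMod 2) F (c * x) ≠ 0 := by
  obtain ⟨y, hy⟩ := Algebra.trace_surjective (ZMod 2) F 1
  exact ⟨y / c, by rw [mul_div_cancel₀ _ hc, hy]; decide⟩

theorem sum_zmodTwoSign_trace_mul [DecidableEq F] (c : F) :
    ∑ x, zmodTwoSign (Algebra.trace (ZMod 2) F (c * x)) =
      if c = 0 then (Fintype.card F : ℤ) else 0 := by
  split_ifs with hc
  · simp [hc]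
  · obtain ⟨x, hx⟩ := exists_trace_mul_ne_zero hc
    exact sum_zmodTwoSign_eq_zero
      ((Algebra.trace (ZMod 2) F).toAddMonoidHom.comp (AddMonoidHom.mulLeft c)) x hx

/-- The Gold power map is almost perfect nonlinear. -/
theorem gold_pow_apn {m e : ℕ} (hF : Fintype.card F = 2 ^ m) (hme : Nat.gcd m e = 1)
    {x y p q : F} (hpq : p ≠ q) (h1 : x + y = p + q)
    (hd : x ^ (2 ^ e + 1) + y ^ (2 ^ e + 1) = p ^ (2 ^ e + 1) + q ^ (2 ^ e + 1)) :
    x = p ∧ y = q ∨ x = q ∧ y = p := by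
  have hs : p + q ≠ 0 := fun h => hpq ((add_eq_zero_iff_of_algebra_zmod_two _ _).mp h)
  have two (z : F) := add_self_eq_zero_of_algebra_zmod_two z
  have hx := gold_pow_add e x y
  have hp := gold_pow_add e p q
  rw [h1, hp, ← hd] at hx
  have h2 : x ^ 2 ^ e * y + x * y ^ 2 ^ e = p ^ 2 ^ e * q + p * q ^ 2 ^ e :=
    (add_left_cancel hx).symm
  have hy : y = x + (p + q) := by linear_combination h1 - two x
  -- With the sum `p + q` fixed, the equation is additive in `x + p`; dividing by `(p + q)^(2^e+1)`
  -- makes `(x + p)/(p + q)` a fixed point of the `e`-th Frobenius power.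
  have h3 : (x + p) ^ 2 ^ e * (p + q) = (x + p) * (p + q) ^ 2 ^ e := by
    rw [hy] at h2
    simp only [pow_two_pow_add] at h2 ⊢
    linear_combination h2 + two (p ^ 2 ^ e * q) - two (x * x ^ 2 ^ e)
      - two (x * (p ^ 2 ^ e + q ^ 2 ^ e))
  have h4 : ((x + p) / (p + q)) ^ 2 ^ e = (x + p) / (p + q) := by
    rw [div_pow, div_eq_div_iff (pow_ne_zero _ hs) hs, h3]
  rcases eq_zero_or_one_of_pow_eq_self hF hme h4 with h | h
  · left
    have h5 : x = p :=
      (add_eq_zero_iff_of_algebra_zmod_two _ _).mp ((div_eq_zero_iff.mp h).resolve_right hs)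
    exact ⟨h5, by rw [h5] at h1; exact add_left_cancel h1⟩
  · right
    have h5 : x = q := by
      rw [div_eq_one_iff_eq hs] at h
      linear_combination h - two p + two p
    exact ⟨h5, by linear_combination h1 - h5⟩

/-- The number of solutions of `z ^ (2 ^ e) + z = c`. -/
theorem card_pow_add_self_eq [DecidableEq F] {m e : ℕ} (hF : Fintype.card F = 2 ^ m)
    (hme : Nat.gcd m e = 1) (c : F) :
    ((Finset.univ.filter (fun z : F => z ^ 2 ^ e + z = c)).card : ℤ) =
      1 + zmodTwoSign (Algebra.trace (ZMod 2) F c) := by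
  have hq : (Fintype.card F : ℤ) ≠ 0 := by exact_mod_cast Fintype.card_ne_zero
  have two (z : F) := add_self_eq_zero_of_algebra_zmod_two z
  have hfrob := pow_two_pow_bijective (F := F) e
  -- The count is detected by the additive characters `z ↦ (-1)^Tr(b z)`.
  have h1 : (Fintype.card F : ℤ) * (Finset.univ.filter (fun z : F => z ^ 2 ^ e + z = c)).card =
      ∑ z : F, ∑ b : F, zmodTwoSign (Algebra.trace (ZMod 2) F ((z ^ 2 ^ e + z + c) * b)) := by
    simp_rw [sum_zmodTwoSign_trace_mul, add_eq_zero_iff_of_algebra_zmod_two]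
    rw [Finset.sum_ite, Finset.sum_const, Finset.sum_const_zero, nsmul_eq_mul]
    ring
  -- Since `Tr(z b) = Tr(z^(2^e) b^(2^e))`, the summand is a character of `z^(2^e)` with coefficient
  -- `b + b^(2^e)`, which is zero only for `b = 0, 1`.
  have h2 (b : F) : ∑ z : F, zmodTwoSign (Algebra.trace (ZMod 2) F ((z ^ 2 ^ e + z + c) * b)) =
      if b = 0 ∨ b = 1 then
        (Fintype.card F : ℤ) * zmodTwoSign (Algebra.trace (ZMod 2) F (c * b)) else 0 := by
    have h3 (z : F) : zmodTwoSign (Algebra.trace (ZMod 2) F ((z ^ 2 ^ e + z + c) * b)) =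
        zmodTwoSign (Algebra.trace (ZMod 2) F ((b + b ^ 2 ^ e) * z ^ 2 ^ e)) *
          zmodTwoSign (Algebra.trace (ZMod 2) F (c * b)) := by
      rw [add_mul, map_add, zmodTwoSign_add, add_mul, add_mul, map_add, map_add,
        ← trace_pow_two_pow e (z * b), mul_pow, mul_comm b, mul_comm (b ^ 2 ^ e)]
    simp_rw [h3]
    rw [← Finset.sum_mul, hfrob.sum_comp
      (fun z => zmodTwoSign (Algebra.trace (ZMod 2) F ((b + b ^ 2 ^ e) * z))),
      sum_zmodTwoSign_trace_mul]
    have h4 : b + b ^ 2 ^ e = 0 ↔ b = 0 ∨ b = 1 := by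
      rw [add_eq_zero_iff_of_algebra_zmod_two]
      constructor
      · exact fun h => eq_zero_or_one_of_pow_eq_self hF hme h.symm
      · rintro (rfl | rfl)
        · rw [zero_pow (pow_ne_zero _ two_ne_zero)]
        · rw [one_pow]
    simp only [h4, ite_mul, zero_mul]
  rw [Finset.sum_comm] at h1
  simp_rw [h2] at h1
  rw [← Finset.sum_filter, show Finset.univ.filter (fun b : F => b = 0 ∨ b = 1) = {0, 1} by
    ext; simp, Finset.sum_pair zero_ne_one, ← mul_add] at h1
  have h5 := mul_left_cancel₀ hq h1
  simpa using h5

theorem trace_one_of_odd {m : ℕ} (hF : Fintype.card F = 2 ^ m) (hmodd : Odd m) :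
    Algebra.trace (ZMod 2) F 1 = 1 := by
  have h := Module.card_eq_pow_finrank (K := ZMod 2) (V := F)
  rw [hF, ZMod.card] at h
  have hm := Nat.pow_right_injective le_rfl h
  have h1 := Algebra.trace_algebraMap (R := ZMod 2) (S := F) (1 : ZMod 2)
  rw [map_one, ← hm, nsmul_one] at h1
  rw [h1]
  exact ZMod.natCast_eq_one_iff_odd.mpr hmodd

/-- The number of ways to write `(s, u)` as the sum of two points of the graph of a Gold
function. -/
theorem card_gold_pairs [DecidableEq F] {m e : ℕ} (hF : Fintype.card F = 2 ^ m)
    (hme : Nat.gcd m e = 1) (hmodd : Odd m) {s : F} (hs : s ≠ 0) (u : F) :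
    ((Finset.univ.filter (fun xy : F × F => xy.1 + xy.2 = s ∧
      xy.1 ^ (2 ^ e + 1) + xy.2 ^ (2 ^ e + 1) = u)).card : ℤ) =
      1 - zmodTwoSign (Algebra.trace (ZMod 2) F (u / s ^ (2 ^ e + 1))) := by
  have two (z : F) := add_self_eq_zero_of_algebra_zmod_two z
  -- Substituting `x = s z` gives `x^(2^e+1) + (x+s)^(2^e+1) = s^(2^e+1) (z^(2^e) + z + 1)`. The
  -- extra `1` has trace `1` because `m` is odd, which reverses the sign in the count.
  have h := card_pow_add_self_eq hF hme (u / s ^ (2 ^ e + 1) + 1)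
  rw [map_add, trace_one_of_odd hF hmodd, zmodTwoSign_add, zmodTwoSign_one, mul_neg, mul_one,
    ← sub_eq_add_neg] at h
  rw [← h]
  congr 1
  have key (z : F) : (s * z) ^ (2 ^ e + 1) + (s * z + s) ^ (2 ^ e + 1) = u ↔
      z ^ 2 ^ e + z = u / s ^ (2 ^ e + 1) + 1 := by
    have h1 : (s * z) ^ (2 ^ e + 1) + (s * z + s) ^ (2 ^ e + 1) =
        s ^ (2 ^ e + 1) * (z ^ 2 ^ e + z + 1) := by
      rw [gold_pow_add]
      linear_combination two ((s * z) ^ (2 ^ e + 1))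
    rw [h1, mul_comm, ← eq_div_iff (pow_ne_zero _ hs)]
    constructor
    · intro h; linear_combination h - two 1
    · intro h; linear_combination h + two 1
  refine Finset.card_bij' (fun xy _ => xy.1 / s) (fun z _ => (s * z, s * z + s)) ?_ ?_ ?_ ?_
  · rintro ⟨x, y⟩ hxy
    simp only [Finset.mem_filter, Finset.mem_univ, true_and] at hxy ⊢
    rw [← key, mul_div_cancel₀ _ hs]
    have : x + s = y := by linear_combination two x - hxy.1
    rw [this]
    exact hxy.2
  · intro z hz
    simp only [Finset.mem_filter, Finset.mem_univ, true_and] at hz ⊢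
    exact ⟨by linear_combination two (s * z), (key z).mpr hz⟩
  · rintro ⟨x, y⟩ hxy
    simp only [Finset.mem_filter, Finset.mem_univ, true_and] at hxy
    ext
    · exact mul_div_cancel₀ _ hs
    · simp only [mul_div_cancel₀ _ hs]
      linear_combination two x - hxy.1
  · intro z _
    exact mul_div_cancel_left₀ _ hs

/-- The Walsh transform of a Gold function, squared. -/
theorem sq_gold_walsh [DecidableEq F] {m e : ℕ} (hF : Fintype.card F = 2 ^ m)
    (hme : Nat.gcd m e = 1) (hmodd : Odd m) {a : F} (ha : a ≠ 0) (b : F) :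
    (∑ x : F, zmodTwoSign (Algebra.trace (ZMod 2) F (a * x ^ (2 ^ e + 1) + b * x))) ^ 2 = 0 ∨
    (∑ x : F, zmodTwoSign (Algebra.trace (ZMod 2) F (a * x ^ (2 ^ e + 1) + b * x))) ^ 2 =
      2 ^ (m + 1) := by
  have two (z : F) := add_self_eq_zero_of_algebra_zmod_two z
  have hfrob := pow_two_pow_bijective (F := F) e
  set Q : F → ZMod 2 := fun x => Algebra.trace (ZMod 2) F (a * x ^ (2 ^ e + 1) + b * x) with hQ
  -- `Q x + Q (x + y) + Q y` is linear in `x`; applying Frobenius inside the trace gathers it into a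
  -- single coefficient of `x^(2^e)`.
  have hpol (x y : F) : zmodTwoSign (Q x) * zmodTwoSign (Q (x + y)) = zmodTwoSign (Q y) *
      zmodTwoSign (Algebra.trace (ZMod 2) F ((a * y + a ^ 2 ^ e * y ^ 2 ^ (2 * e)) * x ^ 2 ^ e)) := by
    rw [← zmodTwoSign_add, ← zmodTwoSign_add]
    congr 1
    have h1 : Algebra.trace (ZMod 2) F (a ^ 2 ^ e * y ^ 2 ^ (2 * e) * x ^ 2 ^ e) =
        Algebra.trace (ZMod 2) F (a * y ^ 2 ^ e * x) := by
      rw [← trace_pow_two_pow e (a * y ^ 2 ^ e * x), mul_pow, mul_pow, ← pow_mul, ← pow_add,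
        ← two_mul]
    rw [add_mul, map_add, h1, ← map_add, hQ, ← map_add, ← map_add]
    congr 1
    rw [gold_pow_add]
    linear_combination two (a * x ^ (2 ^ e + 1) + b * x)
  -- The solution of `a y^(2^e+1) = 1` spans the radical of the polar form of `Q`.
  obtain ⟨y, hy⟩ := (gold_pow_bijective hF hme hmodd).2 a⁻¹
  simp only at hy
  have hy0 : y ≠ 0 := fun h => by
    rw [h, zero_pow (Nat.succ_ne_zero _)] at hy
    exact inv_ne_zero ha hy.symm
  have hrad (z : F) : a * z + a ^ 2 ^ e * z ^ 2 ^ (2 * e) = 0 ↔ z = 0 ∨ z = y := by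
    -- Multiplied by `z^(2^e)`, the radical equation becomes `w + w^(2^e) = 0` for `w = a
    -- z^(2^e+1)`, so `w` is `0` or `1`.
    have hmul : (a * z + a ^ 2 ^ e * z ^ 2 ^ (2 * e)) * z ^ 2 ^ e =
        a * z ^ (2 ^ e + 1) + (a * z ^ (2 ^ e + 1)) ^ 2 ^ e := by
      rw [two_mul, pow_add 2 e e, pow_mul]
      ring
    constructor
    · intro h
      rw [h, zero_mul] at hmul
      have h1 := (add_eq_zero_iff_of_algebra_zmod_two _ _).mp hmul.symm
      rcases eq_zero_or_one_of_pow_eq_self hF hme h1.symm with h2 | h2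
      · left
        exact (pow_eq_zero_iff (Nat.succ_ne_zero _)).mp ((mul_eq_zero.mp h2).resolve_left ha)
      · right
        apply (gold_pow_bijective hF hme hmodd).1
        simp only
        rw [hy]
        exact eq_inv_of_mul_eq_one_right h2
    · rintro (rfl | rfl)
      · simp
      · rw [hy, mul_inv_cancel₀ ha, one_pow, two] at hmul
        exact (mul_eq_zero.mp hmul).resolve_right (pow_ne_zero _ hy0)
  have hsq : (∑ x : F, zmodTwoSign (Q x)) ^ 2 =
      2 ^ m * (zmodTwoSign (Q 0) + zmodTwoSign (Q y)) := by
    calc (∑ x : F, zmodTwoSign (Q x)) ^ 2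
        = ∑ x : F, ∑ z : F, zmodTwoSign (Q x) * zmodTwoSign (Q (x + z)) := by
          rw [sq, Finset.sum_mul]
          refine Finset.sum_congr rfl fun x _ => ?_
          rw [← Finset.mul_sum, ← Equiv.sum_comp (Equiv.addLeft x) (fun z => zmodTwoSign (Q z))]
          rfl
      _ = ∑ z : F, ∑ x : F, zmodTwoSign (Q x) * zmodTwoSign (Q (x + z)) := Finset.sum_comm
      _ = ∑ z : F, if z = 0 ∨ z = y then zmodTwoSign (Q z) * 2 ^ m else 0 := by
          refine Finset.sum_congr rfl fun z _ => ?_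
          simp_rw [hpol]
          rw [← Finset.mul_sum, hfrob.sum_comp (fun x => zmodTwoSign (Algebra.trace (ZMod 2) F
            ((a * z + a ^ 2 ^ e * z ^ 2 ^ (2 * e)) * x))), sum_zmodTwoSign_trace_mul, hF]
          simp only [hrad, mul_ite, mul_zero]
          push_cast
          rfl
      _ = _ := by
          rw [← Finset.sum_filter, show Finset.univ.filter (fun b : F => b = 0 ∨ b = y) = {0, y} by
            ext; simp, Finset.sum_pair hy0.symm]
          ring
  have hQ0 : Q 0 = 0 := by simp [hQ]
  rw [hsq, hQ0]
  rcases ZMod.two_eq_zero_or_one (Q y) with h | h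
  · right; rw [h, zmodTwoSign_zero]; ring
  · left; rw [h]; simp

end Field

/-! ### Pairs of graph points matching the sums over a set -/

/-- The number of pairs of points of the graph of the Gold function whose sum agrees with the sum
over `T`, provided that `T` has even cardinality. -/
def goldPairCount {F : Type*} [Field F] [Fintype F] [DecidableEq F] (e : ℕ) (T : Finset F) : ℕ :=
  (Finset.univ.filter (fun xy : F × F => xy.1 ^ (2 ^ e + 1) + xy.2 ^ (2 ^ e + 1) =
    ∑ x ∈ T, x ^ (2 ^ e + 1) ∧ xy.1 + xy.2 = ∑ x ∈ T, x ∧ (0 : ZMod 2) = T.card)).card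

theorem goldPairCount_odd {F : Type*} [Field F] [Fintype F] [DecidableEq F] {e : ℕ} {T : Finset F} (hT : Odd T.card) : goldPairCount e T = 0 := by
  rw [goldPairCount, Finset.card_eq_zero, Finset.filter_eq_empty_iff]
  intro xy _ h
  rw [ZMod.natCast_eq_one_iff_odd.mpr hT] at h
  exact zero_ne_one h.2.2

/-! ### Parametrized trace words and their moments -/

section TraceWord

variable {F : Type*} [Field F] [Algebra (ZMod 2) F]

/-- The word `x ↦ Tr(a f(x) + b x) + t` attached to the triple `(a, b, t)`. -/
noncomputable def traceWord (f : F → F) : (F × F × ZMod 2) →ₗ[ZMod 2] (F → ZMod 2) where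
  toFun p x := Algebra.trace (ZMod 2) F (p.1 * f x + p.2.1 * x) + p.2.2
  map_add' p p' := by
    funext x
    simp only [Prod.fst_add, Prod.snd_add, Pi.add_apply, add_mul, map_add]
    ring
  map_smul' k p := by
    funext x
    simp only [Prod.smul_fst, Prod.smul_snd, Pi.smul_apply, smul_mul_assoc, map_add, map_smul,
      RingHom.id_apply, smul_add]

theorem traceWord_apply (f : F → F) (p : F × F × ZMod 2) (x : F) :
    traceWord f p x = Algebra.trace (ZMod 2) F (p.1 * f x + p.2.1 * x) + p.2.2 := rfl

/-- A sum of values of a trace word, as a linear functional of the triple. -/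
theorem sum_traceWord (f : F → F) (p : F × F × ZMod 2) (S : Finset F) :
    ∑ x ∈ S, traceWord f p x =
      Algebra.trace (ZMod 2) F (p.1 * ∑ x ∈ S, f x + p.2.1 * ∑ x ∈ S, x) + p.2.2 * S.card := by
  simp only [traceWord_apply, Finset.sum_add_distrib, map_add, Finset.mul_sum, map_sum,
    Finset.sum_const, nsmul_eq_mul, mul_comm p.2.2]

variable [Fintype F]

/-- By surjectivity of the trace, `Tr c` runs through all of `ZMod 2`; replacing `c` by this bit
removes the redundancy in the parametrization. -/
theorem range_traceWord (f : F → F) : LinearMap.range (traceWord f) = traceCode 2 F f := by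
  ext u
  constructor
  · rintro ⟨p, rfl⟩
    obtain ⟨c, hc⟩ := Algebra.trace_surjective (ZMod 2) F p.2.2
    refine ⟨p.1, p.2.1, c, ?_⟩
    funext x
    rw [traceWord_apply, map_add _ _ c, hc]
  · rintro ⟨a, b, c, rfl⟩
    refine ⟨(a, b, Algebra.trace (ZMod 2) F c), ?_⟩
    funext x
    rw [traceWord_apply, ← map_add]

variable [DecidableEq F]

theorem sum_zmodTwoSign_functional (A B : F) (n : ZMod 2) :
    ∑ p : F × F × ZMod 2,
      zmodTwoSign (Algebra.trace (ZMod 2) F (p.1 * A + p.2.1 * B) + p.2.2 * n) =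
      if A = 0 ∧ B = 0 ∧ n = 0 then 2 * (Fintype.card F : ℤ) ^ 2 else 0 := by
  have hn : ∑ t : ZMod 2, zmodTwoSign (t * n) = if n = 0 then 2 else 0 := by
    revert n; decide
  have hF (A : F) : ∑ x : F, zmodTwoSign (Algebra.trace (ZMod 2) F (x * A)) =
      if A = 0 then (Fintype.card F : ℤ) else 0 := by
    rw [← sum_zmodTwoSign_trace_mul]
    simp only [mul_comm]
  simp only [Fintype.sum_prod_type, map_add, zmodTwoSign_add, ← Finset.mul_sum, ← Finset.sum_mul,
    hn, hF]
  by_cases h1 : A = 0 <;> by_cases h2 : B = 0 <;> by_cases h3 : n = 0 <;> simp [h1, h2, h3]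
  ring

/-- The triples whose trace words vanish on `T`. -/
noncomputable def vanishingTriples (f : F → F) (T : Finset F) : Finset (F × F × ZMod 2) :=
  {p | ∀ t ∈ T, traceWord f p t = 0}

theorem mem_vanishingTriples {f : F → F} {T : Finset F} {p : F × F × ZMod 2} :
    p ∈ vanishingTriples f T ↔ ∀ t ∈ T, traceWord f p t = 0 := by
  simp [vanishingTriples]

/-- Power moments over the words that vanish on `T` count additive relations. -/
theorem sum_vanishingTriples {ι : Type*} [Fintype ι] (f : F → F) (T : Finset F) (A B : ι → F)
    (n : ι → ZMod 2) :
    2 ^ T.card * ∑ p ∈ vanishingTriples f T, ∑ i,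
      zmodTwoSign (Algebra.trace (ZMod 2) F (p.1 * A i + p.2.1 * B i) + p.2.2 * n i) =
    2 * (Fintype.card F : ℤ) ^ 2 * ∑ S ∈ T.powerset,
      ((Finset.univ.filter fun i =>
        A i = ∑ x ∈ S, f x ∧ B i = ∑ x ∈ S, x ∧ n i = S.card).card : ℤ) := by
  have h1 (S : Finset F) (i : ι) (p : F × F × ZMod 2) :
      zmodTwoSign (∑ t ∈ S, traceWord f p t) *
        zmodTwoSign (Algebra.trace (ZMod 2) F (p.1 * A i + p.2.1 * B i) + p.2.2 * n i) =
      zmodTwoSign (Algebra.trace (ZMod 2) F (p.1 * (A i + ∑ x ∈ S, f x) +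
        p.2.1 * (B i + ∑ x ∈ S, x)) + p.2.2 * (n i + S.card)) := by
    rw [← zmodTwoSign_add, sum_traceWord]
    congr 1
    simp only [mul_add, map_add]
    ring
  calc _ = ∑ p, (if ∀ t ∈ T, traceWord f p t = 0 then 2 ^ T.card else 0) * ∑ i,
      zmodTwoSign (Algebra.trace (ZMod 2) F (p.1 * A i + p.2.1 * B i) + p.2.2 * n i) := by
        rw [vanishingTriples, Finset.sum_filter, Finset.mul_sum]
        refine Finset.sum_congr rfl fun p _ => ?_
        split_ifs <;> simp
    -- The indicator of vanishing on `T` is expanded over subsets, so that the sum over all triples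
    -- can be done first by orthogonality.
    _ = ∑ S ∈ T.powerset, ∑ i, ∑ p, zmodTwoSign (∑ t ∈ S, traceWord f p t) *
        zmodTwoSign (Algebra.trace (ZMod 2) F (p.1 * A i + p.2.1 * B i) + p.2.2 * n i) := by
        simp only [← Finset.mul_sum, Finset.sum_comm (s := (Finset.univ : Finset ι))]
        rw [Finset.sum_comm]
        refine Finset.sum_congr rfl fun p _ => ?_
        rw [← Finset.sum_mul, sum_prod_one_add_zmodTwoSign]
        split_ifs <;> rfl
    _ = _ := by
        simp_rw [h1, sum_zmodTwoSign_functional, add_eq_zero_iff_of_algebra_zmod_two]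
        rw [Finset.mul_sum]
        refine Finset.sum_congr rfl fun S _ => ?_
        rw [Finset.sum_ite, Finset.sum_const, Finset.sum_const_zero, nsmul_eq_mul]
        ring

/-- The sum of the signs of a word. -/
theorem sum_zmodTwoSign_eq_sub_hammingNorm {ι : Type*} [Fintype ι] (u : ι → ZMod 2) :
    ∑ x, zmodTwoSign (u x) = Fintype.card ι - 2 * (hammingNorm u : ℤ) := by
  have h (x : ι) : zmodTwoSign (u x) = 1 - 2 * (if u x ≠ 0 then 1 else 0) := by
    rcases ZMod.two_eq_zero_or_one (u x) with h | h <;> simp [h]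
  simp_rw [h, Finset.sum_sub_distrib, ← Finset.mul_sum, hammingNorm, Finset.sum_boole]
  simp

/-! ### Short additive relations on the Gold graph and the first three moments -/

variable {m e : ℕ}

/-- Parity excludes odd sizes, a two-element relation forces equal elements, and a four-element one
splits into two pairs with equal sums, contradicting the APN property. -/
theorem gold_relations_zero (hF : Fintype.card F = 2 ^ m) (hme : Nat.gcd m e = 1) {S : Finset F}
    (hS : S.card ≤ 4) (hd : ∑ x ∈ S, x ^ (2 ^ e + 1) = 0) (h1 : ∑ x ∈ S, x = 0)
    (hn : (S.card : ZMod 2) = 0) : S = ∅ := by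
  have hlt : S.card < 5 := by omega
  interval_cases hc : S.card
  · exact Finset.card_eq_zero.mp hc
  · exact absurd hn (by decide)
  · obtain ⟨x, y, hxy, rfl⟩ := Finset.card_eq_two.mp hc
    rw [Finset.sum_pair hxy] at h1
    exact absurd ((add_eq_zero_iff_of_algebra_zmod_two _ _).mp h1) hxy
  · exact absurd hn (by decide)
  · obtain ⟨x, y, z, w, hxy, hxz, hxw, hyz, hyw, hzw, rfl⟩ := Finset.card_eq_four.mp hc
    rw [Finset.sum_insert (by simp [*]), Finset.sum_insert (by simp [*]), Finset.sum_pair hzw,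
      ← add_assoc, add_eq_zero_iff_of_algebra_zmod_two] at hd h1
    rcases gold_pow_apn hF hme hzw h1 hd with h | h
    · exact absurd h.1 hxz
    · exact absurd h.1 hxw

/-- In the only nontrivial case, `S = {y, z, w}`, moving `y` across gives two pairs with equal sums.
APN only needs `z ≠ w`, so `x` may lie in `S`. -/
theorem gold_relations_one (hF : Fintype.card F = 2 ^ m) (hme : Nat.gcd m e = 1) {S : Finset F}
    (hS : S.card ≤ 4) (x : F) (hd : x ^ (2 ^ e + 1) = ∑ x ∈ S, x ^ (2 ^ e + 1))
    (h1 : x = ∑ x ∈ S, x) (hn : 1 = (S.card : ZMod 2)) : S = {x} := by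
  have hlt : S.card < 5 := by omega
  interval_cases hc : S.card
  · exact absurd hn (by decide)
  · obtain ⟨y, rfl⟩ := Finset.card_eq_one.mp hc
    rw [h1, Finset.sum_singleton]
  · exact absurd hn (by decide)
  · obtain ⟨y, z, w, hyz, hyw, hzw, rfl⟩ := Finset.card_eq_three.mp hc
    rw [Finset.sum_insert (by simp [*]), Finset.sum_pair hzw] at hd h1
    have two (z : F) := add_self_eq_zero_of_algebra_zmod_two z
    have h2 : x + y = z + w := by linear_combination h1 + two y
    have h3 : x ^ (2 ^ e + 1) + y ^ (2 ^ e + 1) = z ^ (2 ^ e + 1) + w ^ (2 ^ e + 1) := by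
      linear_combination hd + two (y ^ (2 ^ e + 1))
    rcases gold_pow_apn hF hme hzw h2 h3 with h | h
    · exact absurd h.2 hyw
    · exact absurd h.2 hyz
  · exact absurd hn (by decide)

theorem goldPairCount_empty (e : ℕ) : goldPairCount e (∅ : Finset F) = Fintype.card F := by
  rw [goldPairCount, ← Finset.card_univ]
  refine Finset.card_bij' (fun xy _ => xy.1) (fun x _ => (x, x)) ?_ ?_ ?_ ?_
  · simp
  · intro x _
    simp [add_self_eq_zero_of_algebra_zmod_two]
  · rintro ⟨x, y⟩ h
    simp only [Finset.mem_filter, Finset.sum_empty, add_eq_zero_iff_of_algebra_zmod_two] at h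
    rw [h.2.2.1]
  · simp

theorem goldPairCount_pair (hF : Fintype.card F = 2 ^ m) (hme : Nat.gcd m e = 1) {p q : F}
    (hpq : p ≠ q) : goldPairCount e ({p, q} : Finset F) = 2 := by
  rw [goldPairCount, Finset.card_eq_two]
  refine ⟨(p, q), (q, p), by simp [hpq], ?_⟩
  ext ⟨x, y⟩
  simp only [Finset.mem_filter, Finset.mem_univ, true_and, Finset.sum_pair hpq,
    Finset.card_pair hpq, Finset.mem_insert, Finset.mem_singleton, Prod.mk.injEq]
  constructor
  · exact fun h => gold_pow_apn hF hme hpq h.2.1 h.1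
  · rintro (⟨rfl, rfl⟩ | ⟨rfl, rfl⟩)
    · exact ⟨rfl, rfl, by decide⟩
    · exact ⟨add_comm _ _, add_comm _ _, by decide⟩

/-- For a nonzero sum this is `card_gold_pairs`. For zero sum a matching pair would have `x = y`,
making `T` itself a forbidden four-term relation. -/
theorem goldPairCount_four (hF : Fintype.card F = 2 ^ m) (hme : Nat.gcd m e = 1) (hmodd : Odd m)
    {T : Finset F} (hT : T.card = 4) :
    goldPairCount e T = if (∑ x ∈ T, x) ≠ 0 ∧ Algebra.trace (ZMod 2) F
      ((∑ x ∈ T, x ^ (2 ^ e + 1)) / (∑ x ∈ T, x) ^ (2 ^ e + 1)) = 1 then 2 else 0 := by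
  have h4 : (0 : ZMod 2) = (T.card : ZMod 2) := by rw [hT]; decide
  by_cases hs : ∑ x ∈ T, x = 0
  · rw [if_neg fun h => h.1 hs, goldPairCount, Finset.card_eq_zero, Finset.filter_eq_empty_iff]
    rintro ⟨x, y⟩ _ ⟨hd, h1, -⟩
    simp only at hd h1
    rw [hs, add_eq_zero_iff_of_algebra_zmod_two] at h1
    rw [h1, add_self_eq_zero_of_algebra_zmod_two] at hd
    have h := gold_relations_zero hF hme hT.le hd.symm hs h4.symm
    rw [h, Finset.card_empty] at hT
    exact absurd hT (by decide)
  · have h := card_gold_pairs hF hme hmodd hs (∑ x ∈ T, x ^ (2 ^ e + 1))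
    have h2 : goldPairCount e T = (Finset.univ.filter (fun xy : F × F => xy.1 + xy.2 = ∑ x ∈ T, x ∧
        xy.1 ^ (2 ^ e + 1) + xy.2 ^ (2 ^ e + 1) = ∑ x ∈ T, x ^ (2 ^ e + 1))).card := by
      rw [goldPairCount]
      congr 1
      ext xy
      simp only [Finset.mem_filter, Finset.mem_univ, true_and]
      exact ⟨fun h => ⟨h.2.1, h.1⟩, fun h => ⟨h.2, h.1, h4⟩⟩
    rw [← h2] at h
    rcases ZMod.two_eq_zero_or_one (Algebra.trace (ZMod 2) F
      ((∑ x ∈ T, x ^ (2 ^ e + 1)) / (∑ x ∈ T, x) ^ (2 ^ e + 1))) with h3 | h3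
    · rw [h3] at h ⊢
      simp at h ⊢
      exact h
    · rw [h3] at h ⊢
      simp [hs] at h ⊢
      omega

/-- The empty set contributes the `2^m` diagonal pairs, each of the six two-element subsets
contributes its two orderings, and odd subsets contribute nothing. -/
theorem sum_goldPairCount (hF : Fintype.card F = 2 ^ m) (hme : Nat.gcd m e = 1)
    {T : Finset F} (hT : T.card = 4) :
    ∑ S ∈ T.powerset, goldPairCount e S = 2 ^ m + 12 + goldPairCount e T := by
  have h (S : Finset F) (hS : S ∈ T.powerset) : goldPairCount e S =
      (fun k => if k = 0 then 2 ^ m else if k = 2 then 2 else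
        if k = 4 then goldPairCount e T else 0) S.card := by
    have hle := Finset.card_le_card (Finset.mem_powerset.mp hS)
    have hlt : S.card < 5 := by omega
    interval_cases hc : S.card
    · rw [Finset.card_eq_zero.mp hc, goldPairCount_empty, hF]
      rfl
    · exact goldPairCount_odd (by rw [hc]; decide)
    · obtain ⟨p, q, hpq, rfl⟩ := Finset.card_eq_two.mp hc
      exact goldPairCount_pair hF hme hpq
    · exact goldPairCount_odd (by rw [hc]; decide)
    · rw [Finset.eq_of_subset_of_card_le (Finset.mem_powerset.mp hS) (by omega)]
      rfl
  rw [Finset.sum_congr rfl h]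
  refine (Finset.sum_powerset_apply_card (fun k => if k = 0 then 2 ^ m else if k = 2 then 2 else
    if k = 4 then goldPairCount e T else 0)).trans ?_
  rw [hT]
  simp [Finset.sum_range_succ, Nat.choose]

theorem card_vanishingTriples (hF : Fintype.card F = 2 ^ m) (hme : Nat.gcd m e = 1)
    {T : Finset F} (hT : T.card = 4) :
    2 ^ 4 * ((vanishingTriples (fun x => x ^ (2 ^ e + 1)) T).card : ℤ) = 2 * (2 ^ m) ^ 2 := by
  have h := sum_vanishingTriples (ι := Unit) (fun x => x ^ (2 ^ e + 1)) T 0 0 0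
  rw [Finset.sum_eq_single_of_mem ∅ (Finset.empty_mem_powerset T)] at h
  · simpa [hF, hT] using h
  · intro S hS h0
    rw [Nat.cast_eq_zero, Finset.card_eq_zero, Finset.filter_eq_empty_iff]
    rintro i - ⟨hd, h1, hn⟩
    exact h0 (gold_relations_zero hF hme (hT ▸ Finset.card_le_card (Finset.mem_powerset.mp hS))
      hd.symm h1.symm hn.symm)

/-- The factor `4` counts the singletons of `T`, the only subsets whose sums agree with a single
graph point. -/
theorem sum_vanishingTriples_sign (hF : Fintype.card F = 2 ^ m) (hme : Nat.gcd m e = 1)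
    {T : Finset F} (hT : T.card = 4) :
    2 ^ 4 * ∑ p ∈ vanishingTriples (fun x => x ^ (2 ^ e + 1)) T,
      ∑ x, zmodTwoSign (traceWord (fun x => x ^ (2 ^ e + 1)) p x) = 2 * (2 ^ m) ^ 2 * 4 := by
  have h := sum_vanishingTriples (fun x => x ^ (2 ^ e + 1)) T
    (fun x => x ^ (2 ^ e + 1)) (fun x => x) (fun _ => 1)
  simp only [mul_one, hT, hF, ← traceWord_apply (fun x => x ^ (2 ^ e + 1))] at h
  rw [h]
  push_cast
  congr 1
  have h1 (S : Finset F) (hS : S ∈ T.powerset) :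
      ((Finset.univ.filter fun x : F => x ^ (2 ^ e + 1) = ∑ y ∈ S, y ^ (2 ^ e + 1) ∧
        x = ∑ y ∈ S, y ∧ 1 = (S.card : ZMod 2)).card : ℤ) =
      (fun k => if k = 1 then (1 : ℤ) else 0) S.card := by
    have hle := Finset.card_le_card (Finset.mem_powerset.mp hS)
    by_cases hc : S.card = 1
    · obtain ⟨y, rfl⟩ := Finset.card_eq_one.mp hc
      rw [show (Finset.univ.filter fun x : F => x ^ (2 ^ e + 1) = ∑ y ∈ {y}, y ^ (2 ^ e + 1) ∧
        x = ∑ y ∈ {y}, y ∧ 1 = (({y} : Finset F).card : ZMod 2)) = {y} by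
          ext x
          simp only [Finset.mem_filter, Finset.mem_univ, true_and, Finset.sum_singleton,
            Finset.mem_singleton, Finset.card_singleton, Nat.cast_one, and_true]
          exact ⟨fun h => h.2, fun h => ⟨by rw [h], h⟩⟩]
      rfl
    · simp only [if_neg hc]
      rw [Nat.cast_eq_zero, Finset.card_eq_zero, Finset.filter_eq_empty_iff]
      rintro x - ⟨hd, h1, hn⟩
      rw [gold_relations_one hF hme (hT ▸ hle) x hd h1 hn] at hc
      exact hc (Finset.card_singleton x)
  rw [Finset.sum_congr rfl h1]
  refine (Finset.sum_powerset_apply_card (fun k => if k = 1 then (1 : ℤ) else 0)).trans ?_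
  rw [hT]
  simp [Nat.choose]

theorem sum_vanishingTriples_sign_sq (hF : Fintype.card F = 2 ^ m) (hme : Nat.gcd m e = 1)
    {T : Finset F} (hT : T.card = 4) :
    2 ^ 4 * ∑ p ∈ vanishingTriples (fun x => x ^ (2 ^ e + 1)) T,
      (∑ x, zmodTwoSign (traceWord (fun x => x ^ (2 ^ e + 1)) p x)) ^ 2 =
    2 * (2 ^ m) ^ 2 * (2 ^ m + 12 + goldPairCount e T) := by
  -- The square is a sum over ordered pairs `(x, y)`. The bit `t` occurs twice and cancels, hence
  -- the third function is `0`; this is the source of the parity clause in `goldPairCount`.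
  have h := sum_vanishingTriples (fun x => x ^ (2 ^ e + 1)) T
    (fun xy : F × F => xy.1 ^ (2 ^ e + 1) + xy.2 ^ (2 ^ e + 1)) (fun xy => xy.1 + xy.2)
    (fun _ => 0)
  rw [hT, hF] at h
  have h2 := sum_goldPairCount hF hme hT
  simp only [goldPairCount] at h2 ⊢
  rw [← Nat.cast_sum, h2] at h
  push_cast at h ⊢
  rw [← h]
  congr 1
  refine Finset.sum_congr rfl fun p _ => ?_
  rw [sq, Finset.sum_mul_sum, ← Fintype.sum_prod_type']
  refine Finset.sum_congr rfl fun xy _ => ?_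
  rw [← zmodTwoSign_add]
  congr 1
  simp only [traceWord_apply, mul_add, map_add, mul_zero]
  have h3 (a b c d t : ZMod 2) : a + b + t + (c + d + t) = a + c + (b + d) + 0 := by
    revert a b c d t; decide
  exact h3 _ _ _ _ _

end TraceWord

theorem hammingNorm_comp_val_of_forall_mem_eq_zero {K ι : Type*} [Field K] [DecidableEq K]
    [Fintype ι] [DecidableEq ι] {T : Finset ι} {u : ι → K} (hu : ∀ i ∈ T, u i = 0) :
    hammingNorm (fun i : {i : ι // i ∉ T} => u i) = hammingNorm u := by
  unfold hammingNorm
  rw [← Finset.card_map (Function.Embedding.subtype _)]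
  congr 1
  ext i
  simp only [Finset.mem_map, Finset.mem_filter, Finset.mem_univ, true_and,
    Function.Embedding.coe_subtype, Subtype.exists, exists_and_left, exists_prop]
  constructor
  · rintro ⟨j, hj, -, rfl⟩
    exact hj
  · exact fun h => ⟨i, h, fun hi => h (hu i hi), rfl⟩

/-! ### Weights of the shortened code -/

section ShortenedGold

variable {F : Type*} [Field F] [Fintype F] [DecidableEq F] [Algebra (ZMod 2) F]

/-- The restriction of a trace word to the complement of `T`. -/
noncomputable def puncturedTraceWord (f : F → F) (T : Finset F) :
    (F × F × ZMod 2) →ₗ[ZMod 2] ({x : F // x ∉ T} → ZMod 2) :=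
  LinearMap.funLeft (ZMod 2) (ZMod 2) Subtype.val ∘ₗ traceWord f

theorem coe_shortenedCode_traceCode (f : F → F) (T : Finset F) :
    (shortenedCode (traceCode 2 F f) T : Set ({x : F // x ∉ T} → ZMod 2)) =
      puncturedTraceWord f T '' vanishingTriples f T := by
  ext u
  constructor
  · rintro ⟨v, ⟨hv, hT⟩, rfl⟩
    rw [← range_traceWord] at hv
    obtain ⟨p, rfl⟩ := hv
    exact ⟨p, mem_vanishingTriples.mpr hT, rfl⟩
  · rintro ⟨p, hp, rfl⟩
    refine ⟨traceWord f p, ⟨?_, mem_vanishingTriples.mp hp⟩, rfl⟩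
    rw [← range_traceWord]
    exact ⟨p, rfl⟩

theorem hammingNorm_puncturedTraceWord {f : F → F} {T : Finset F} {p : F × F × ZMod 2}
    (hp : p ∈ vanishingTriples f T) :
    hammingNorm (puncturedTraceWord f T p) = hammingNorm (traceWord f p) :=
  hammingNorm_comp_val_of_forall_mem_eq_zero (mem_vanishingTriples.mp hp)

variable {m e : ℕ}

/-- The bit `t` only changes the sign of the sum. If `a = b = 0`, the word is constant and vanishes
at a point of `T`, so the triple is zero; this is where `T` must be nonempty. -/
theorem sq_sum_sign_gold (hF : Fintype.card F = 2 ^ m) (hme : Nat.gcd m e = 1) (hmodd : Odd m)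
    {T : Finset F} (hT : T.Nonempty) {p : F × F × ZMod 2}
    (hp : p ∈ vanishingTriples (fun x => x ^ (2 ^ e + 1)) T) (h0 : p ≠ 0) :
    (∑ x, zmodTwoSign (traceWord (fun x => x ^ (2 ^ e + 1)) p x)) ^ 2 = 0 ∨
    (∑ x, zmodTwoSign (traceWord (fun x => x ^ (2 ^ e + 1)) p x)) ^ 2 = 2 ^ (m + 1) := by
  obtain ⟨a, b, t⟩ := p
  simp only [traceWord_apply, zmodTwoSign_add, ← Finset.sum_mul, mul_pow]
  rw [sq (zmodTwoSign t), zmodTwoSign_mul_self, mul_one]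
  by_cases ha : a = 0
  · subst ha
    left
    by_cases hb : b = 0
    · subst hb
      obtain ⟨x, hx⟩ := hT
      have h := mem_vanishingTriples.mp hp x hx
      simp only [traceWord_apply, zero_mul, add_zero, map_zero, zero_add] at h
      exact absurd (by rw [h]; rfl) h0
    · simp only [zero_mul, zero_add, sum_zmodTwoSign_trace_mul, if_neg hb]
      rfl
  · exact sq_gold_walsh hF hme hmodd ha b

theorem hammingNorm_gold {j : ℕ} (hF : Fintype.card F = 2 ^ (2 * j + 5))
    (hme : Nat.gcd (2 * j + 5) e = 1) {T : Finset F} (hT : T.Nonempty) {p : F × F × ZMod 2}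
    (hp : p ∈ vanishingTriples (fun x => x ^ (2 ^ e + 1)) T) (h0 : p ≠ 0) :
    hammingNorm (traceWord (fun x => x ^ (2 ^ e + 1)) p) = 2 ^ (2 * j + 4) - 2 ^ (j + 2) ∨
    hammingNorm (traceWord (fun x => x ^ (2 ^ e + 1)) p) = 2 ^ (2 * j + 4) ∨
    hammingNorm (traceWord (fun x => x ^ (2 ^ e + 1)) p) = 2 ^ (2 * j + 4) + 2 ^ (j + 2) := by
  have h := sq_sum_sign_gold hF hme ⟨j + 2, by ring⟩ hT hp h0
  rw [sum_zmodTwoSign_eq_sub_hammingNorm, hF] at h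
  push_cast at h
  generalize hammingNorm (traceWord (fun x => x ^ (2 ^ e + 1)) p) = n at h ⊢
  have e1 : (2 : ℤ) ^ (2 * j + 5) = 2 * 2 ^ (2 * j + 4) := by ring
  have e2 : (2 : ℤ) ^ (2 * j + 5 + 1) = (2 * 2 ^ (j + 2)) ^ 2 := by ring
  rw [e1, e2] at h
  have hle : 2 ^ (j + 2) ≤ 2 ^ (2 * j + 4) := Nat.pow_le_pow_right two_pos (by omega)
  zify [hle]
  rcases h with h | h
  · have := pow_eq_zero_iff two_ne_zero |>.mp h
    omega
  · rcases sq_eq_sq_iff_eq_or_eq_neg.mp h with h | h <;> omega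

/-- The difference of two triples with the same image would be a nonzero triple of weight `0`,
whereas all three possible weights are positive. -/
theorem injOn_puncturedTraceWord_gold {j : ℕ} (hF : Fintype.card F = 2 ^ (2 * j + 5))
    (hme : Nat.gcd (2 * j + 5) e = 1) {T : Finset F} (hT : T.Nonempty) :
    Set.InjOn (puncturedTraceWord (fun x => x ^ (2 ^ e + 1)) T)
      (vanishingTriples (fun x => x ^ (2 ^ e + 1)) T) := by
  intro p hp p' hp' h
  by_contra hne
  have hsub : p - p' ∈ vanishingTriples (fun x => x ^ (2 ^ e + 1)) T := by
    rw [mem_vanishingTriples]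
    intro t ht
    rw [map_sub, Pi.sub_apply, mem_vanishingTriples.mp hp t ht, mem_vanishingTriples.mp hp' t ht,
      sub_zero]
  have h1 := hammingNorm_puncturedTraceWord hsub
  rw [map_sub, sub_eq_zero.mpr h, hammingNorm_zero] at h1
  have h2 := hammingNorm_gold hF hme hT hsub (sub_ne_zero.mpr hne)
  have h3 : 2 ^ (j + 2) < 2 ^ (2 * j + 4) := Nat.pow_lt_pow_right one_lt_two (by omega)
  have h4 : 0 < 2 ^ (j + 2) := by positivity
  omega

/-- The number of triples whose words vanish on `T` and have weight `w`. -/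
noncomputable def goldWeightCount (e : ℕ) (T : Finset F) (w : ℕ) : ℕ :=
  ((vanishingTriples (fun x => x ^ (2 ^ e + 1)) T).filter fun p =>
    hammingNorm (traceWord (fun x => x ^ (2 ^ e + 1)) p) = w).card

theorem weightCount_shortenedCode_gold {j : ℕ} (hF : Fintype.card F = 2 ^ (2 * j + 5))
    (hme : Nat.gcd (2 * j + 5) e = 1) {T : Finset F} (hT : T.Nonempty) (w : ℕ) :
    weightCount (shortenedCode (traceCode 2 F (fun x => x ^ (2 ^ e + 1))) T) w =
      goldWeightCount e T w := by
  rw [weightCount, goldWeightCount, ← Set.ncard_coe_finset,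
    ← ((injOn_puncturedTraceWord_gold hF hme hT).mono
      (Finset.coe_subset.mpr (Finset.filter_subset _ _))).ncard_image]
  congr 1
  ext u
  have hu := Set.ext_iff.mp
    (coe_shortenedCode_traceCode (fun x : F => x ^ (2 ^ e + 1)) T) u
  rw [SetLike.mem_coe] at hu
  rw [Set.mem_ofPred_eq, hu]
  constructor
  · rintro ⟨⟨p, hp, rfl⟩, h⟩
    rw [hammingNorm_puncturedTraceWord hp] at h
    exact ⟨p, Finset.mem_filter.mpr ⟨hp, h⟩, rfl⟩
  · rintro ⟨p, hp, rfl⟩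
    obtain ⟨hp, h⟩ := Finset.mem_filter.mp hp
    exact ⟨⟨p, hp, rfl⟩, (hammingNorm_puncturedTraceWord hp).trans h⟩

theorem finrank_shortenedCode_gold {j : ℕ} (hF : Fintype.card F = 2 ^ (2 * j + 5))
    (hme : Nat.gcd (2 * j + 5) e = 1) {T : Finset F} (hT : T.card = 4) :
    Module.finrank (ZMod 2) (shortenedCode (traceCode 2 F (fun x => x ^ (2 ^ e + 1))) T) =
      4 * j + 7 := by
  have h := Module.natCard_eq_pow_finrank (K := ZMod 2)
    (V := shortenedCode (traceCode 2 F (fun x => x ^ (2 ^ e + 1))) T)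
  have hne : T.Nonempty := Finset.card_pos.mp (by omega)
  have hcard := Nat.card_coe_set_eq
    (shortenedCode (traceCode 2 F (fun x => x ^ (2 ^ e + 1))) T : Set ({x : F // x ∉ T} → ZMod 2))
  rw [SetLike.coe_sort_coe, h, coe_shortenedCode_traceCode,
    (injOn_puncturedTraceWord_gold hF hme hne).ncard_image, Set.ncard_coe_finset,
    Nat.card_zmod] at hcard
  have h1 := card_vanishingTriples hF hme hT
  have h2 : (2 : ℤ) * (2 ^ (2 * j + 5)) ^ 2 = 2 ^ 4 * (2 ^ (4 * j + 7) : ℕ) := by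
    push_cast; ring
  rw [h2] at h1
  have h3 := mul_left_cancel₀ (by norm_num) h1
  rw [Nat.cast_inj, ← hcard] at h3
  exact Nat.pow_right_injective le_rfl h3

theorem goldWeightCount_zero {j : ℕ} (hF : Fintype.card F = 2 ^ (2 * j + 5))
    (hme : Nat.gcd (2 * j + 5) e = 1) {T : Finset F} (hT : T.Nonempty) :
    goldWeightCount e T 0 = 1 := by
  rw [goldWeightCount, Finset.card_eq_one]
  refine ⟨0, ?_⟩
  ext p
  rw [Finset.mem_filter, Finset.mem_singleton]
  constructor
  · rintro ⟨hp, h⟩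
    by_contra h0
    have h2 := hammingNorm_gold hF hme hT hp h0
    have h3 : 2 ^ (j + 2) < 2 ^ (2 * j + 4) := Nat.pow_lt_pow_right one_lt_two (by omega)
    have h4 : 0 < 2 ^ (j + 2) := by positivity
    omega
  · rintro rfl
    rw [mem_vanishingTriples, map_zero]
    exact ⟨fun _ _ => rfl, hammingNorm_zero⟩

theorem goldWeightCount_eq_zero {j : ℕ} (hF : Fintype.card F = 2 ^ (2 * j + 5))
    (hme : Nat.gcd (2 * j + 5) e = 1) {T : Finset F} (hT : T.Nonempty) {w : ℕ} (h0 : w ≠ 0)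
    (h1 : w ≠ 2 ^ (2 * j + 4) - 2 ^ (j + 2)) (h2 : w ≠ 2 ^ (2 * j + 4))
    (h3 : w ≠ 2 ^ (2 * j + 4) + 2 ^ (j + 2)) : goldWeightCount e T w = 0 := by
  rw [goldWeightCount, Finset.card_eq_zero, Finset.filter_eq_empty_iff]
  rintro p hp rfl
  by_cases hp0 : p = 0
  · rw [hp0, map_zero, hammingNorm_zero] at h0
    exact h0 rfl
  · rcases hammingNorm_gold hF hme hT hp hp0 with h | h | h
    exacts [h1 h, h2 h, h3 h]

/-- Grouping by weight, with the zero triple giving `g(q)`, allows the three moments to be read off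
from `g = 1, x, x^2`. -/
theorem sum_weight_gold {j : ℕ} (hF : Fintype.card F = 2 ^ (2 * j + 5))
    (hme : Nat.gcd (2 * j + 5) e = 1) {T : Finset F} (hT : T.Nonempty) (g : ℤ → ℤ) :
    ∑ p ∈ vanishingTriples (fun x => x ^ (2 ^ e + 1)) T,
      g (∑ x, zmodTwoSign (traceWord (fun x => x ^ (2 ^ e + 1)) p x)) =
    g (2 ^ (2 * j + 5)) +
      goldWeightCount e T (2 ^ (2 * j + 4) - 2 ^ (j + 2)) * g (2 ^ (j + 3)) +
      goldWeightCount e T (2 ^ (2 * j + 4)) * g 0 +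
      goldWeightCount e T (2 ^ (2 * j + 4) + 2 ^ (j + 2)) * g (- 2 ^ (j + 3)) := by
  have h3 : 2 ^ (j + 2) < 2 ^ (2 * j + 4) := Nat.pow_lt_pow_right one_lt_two (by omega)
  have h4 : 0 < 2 ^ (j + 2) := by positivity
  have hmaps : ∀ p ∈ vanishingTriples (fun x : F => x ^ (2 ^ e + 1)) T,
      hammingNorm (traceWord (fun x => x ^ (2 ^ e + 1)) p) ∈
        ({0, 2 ^ (2 * j + 4) - 2 ^ (j + 2), 2 ^ (2 * j + 4), 2 ^ (2 * j + 4) + 2 ^ (j + 2)} :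
          Finset ℕ) := by
    intro p hp
    simp only [Finset.mem_insert, Finset.mem_singleton]
    by_cases hp0 : p = 0
    · left
      rw [hp0, map_zero, hammingNorm_zero]
    · exact Or.inr (hammingNorm_gold hF hme hT hp hp0)
  simp_rw [sum_zmodTwoSign_eq_sub_hammingNorm, hF]
  rw [← Finset.sum_fiberwise_of_maps_to' hmaps
    (fun n => g (((2 ^ (2 * j + 5) : ℕ) : ℤ) - 2 * (n : ℤ)))]
  rw [Finset.sum_insert (by simp only [Finset.mem_insert, Finset.mem_singleton]; omega),
    Finset.sum_insert (by simp only [Finset.mem_insert, Finset.mem_singleton]; omega),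
    Finset.sum_pair (by omega)]
  simp only [Finset.sum_const, nsmul_eq_mul]
  have hfold (w : ℕ) : ((vanishingTriples (fun x : F => x ^ (2 ^ e + 1)) T).filter fun p =>
    hammingNorm (traceWord (fun x => x ^ (2 ^ e + 1)) p) = w).card = goldWeightCount e T w := rfl
  simp only [hfold]
  rw [goldWeightCount_zero hF hme hT]
  push_cast [h3.le]
  ring_nf

theorem goldWeightCount_equations {j : ℕ} (hF : Fintype.card F = 2 ^ (2 * j + 5))
    (hme : Nat.gcd (2 * j + 5) e = 1) {T : Finset F} (hT : T.card = 4) :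
    (goldWeightCount e T (2 ^ (2 * j + 4) - 2 ^ (j + 2)) : ℚ) =
      (4 + goldPairCount e T) * 2 ^ (2 * j) - 2 ^ (j + 1) + 2 ^ (4 * j + 5) + 2 ^ (3 * j + 5) ∧
    (goldWeightCount e T (2 ^ (2 * j + 4)) : ℚ) =
      2 ^ (4 * j + 6) - 1 - 2 * (4 + goldPairCount e T) * 2 ^ (2 * j) ∧
    (goldWeightCount e T (2 ^ (2 * j + 4) + 2 ^ (j + 2)) : ℚ) =
      (4 + goldPairCount e T) * 2 ^ (2 * j) + 2 ^ (j + 1) + 2 ^ (4 * j + 5) - 2 ^ (3 * j + 5) := by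
  have hne : T.Nonempty := Finset.card_pos.mp (by omega)
  have h0 := card_vanishingTriples hF hme hT
  have h1 := sum_vanishingTriples_sign hF hme hT
  have h2 := sum_vanishingTriples_sign_sq hF hme hT
  have s0 := sum_weight_gold hF hme hne (fun _ => 1)
  have s1 := sum_weight_gold hF hme hne (fun x => x)
  have s2 := sum_weight_gold hF hme hne (fun x => x ^ 2)
  rw [Finset.sum_const, nsmul_eq_mul, mul_one] at s0
  rw [s0] at h0
  rw [s1] at h1
  rw [s2] at h2
  generalize goldWeightCount e T (2 ^ (2 * j + 4) - 2 ^ (j + 2)) = a at h0 h1 h2 ⊢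
  generalize goldWeightCount e T (2 ^ (2 * j + 4)) = b at h0 h1 h2 ⊢
  generalize goldWeightCount e T (2 ^ (2 * j + 4) + 2 ^ (j + 2)) = c at h0 h1 h2 ⊢
  generalize goldPairCount e T = n at h2 ⊢
  replace h0 := congrArg (Int.cast : ℤ → ℚ) h0
  replace h1 := congrArg (Int.cast : ℤ → ℚ) h1
  replace h2 := congrArg (Int.cast : ℤ → ℚ) h2
  push_cast at h0 h1 h2
  have e1 : (2 : ℚ) ^ (2 * j + 5) = 32 * (2 ^ j) ^ 2 := by ring
  have e2 : (2 : ℚ) ^ (j + 3) = 8 * 2 ^ j := by ring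
  have e3 : (2 : ℚ) ^ (j + 1) = 2 * 2 ^ j := by ring
  have e4 : (2 : ℚ) ^ (4 * j + 5) = 32 * (2 ^ j) ^ 4 := by ring
  have e5 : (2 : ℚ) ^ (3 * j + 5) = 32 * (2 ^ j) ^ 3 := by ring
  have e6 : (2 : ℚ) ^ (4 * j + 6) = 64 * (2 ^ j) ^ 4 := by ring
  have e7 : (2 : ℚ) ^ (2 * j) = (2 ^ j) ^ 2 := by ring
  have hy : (2 : ℚ) ^ j ≠ 0 := by positivity
  rw [e1] at h0
  rw [e1, e2] at h1 h2
  rw [e3, e4, e5, e6, e7]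
  generalize (2 : ℚ) ^ j = y at *
  -- With `y = 2^j`, the nonzero values of `W` are `±8y` off the zero triple. The first moment
  -- yields `a - c` after division by `16 * 8y`, the second yields `a + c` after division by `16 *
  -- 64y^2`; the total count then gives `b`.
  have d : (a : ℚ) - c = 64 * y ^ 3 - 4 * y := by
    apply mul_left_cancel₀ (show (128 : ℚ) * y ≠ 0 by simpa using hy)
    linear_combination h1
  have s : (a : ℚ) + c = 2 * (4 + n) * y ^ 2 + 64 * y ^ 4 := by
    apply mul_left_cancel₀ (show (1024 : ℚ) * y ^ 2 ≠ 0 by simpa using hy)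
    linear_combination h2
  refine ⟨by linear_combination (s + d) / 2, by linear_combination h0 / 16 - s,
    by linear_combination (s - d) / 2⟩

theorem minDist_shortenedCode_gold {j : ℕ} (hF : Fintype.card F = 2 ^ (2 * j + 5))
    (hme : Nat.gcd (2 * j + 5) e = 1) {T : Finset F} (hT : T.card = 4) :
    IsLeast {r : ℕ | ∃ u ∈ shortenedCode (traceCode 2 F (fun x => x ^ (2 ^ e + 1))) T,
      ∃ v ∈ shortenedCode (traceCode 2 F (fun x => x ^ (2 ^ e + 1))) T,
        u ≠ v ∧ hammingDist u v = r} (2 ^ (2 * j + 4) - 2 ^ (j + 2)) := by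
  have hne : T.Nonempty := Finset.card_pos.mp (by omega)
  have h3 : 2 ^ (j + 2) < 2 ^ (2 * j + 4) := Nat.pow_lt_pow_right one_lt_two (by omega)
  have hmem (u) := Set.ext_iff.mp
    (coe_shortenedCode_traceCode (fun x : F => x ^ (2 ^ e + 1)) T) u
  simp only [SetLike.mem_coe] at hmem
  constructor
  · have hpos : 0 < goldWeightCount e T (2 ^ (2 * j + 4) - 2 ^ (j + 2)) := by
      have h := (goldWeightCount_equations hF hme hT).1
      -- The only negative term of the multiplicity is absorbed by `2^(3j+5)`, so the smallest
      -- weight is attained.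
      have h1 : (2 : ℚ) ^ (j + 1) ≤ 2 ^ (3 * j + 5) := pow_le_pow_right₀ one_le_two (by omega)
      have h2 : (0 : ℚ) < 2 ^ (4 * j + 5) := by positivity
      have h5 : (0 : ℚ) ≤ (4 + goldPairCount e T) * 2 ^ (2 * j) := by positivity
      have h6 : (0 : ℚ) < goldWeightCount e T (2 ^ (2 * j + 4) - 2 ^ (j + 2)) := by linarith
      exact_mod_cast h6
    obtain ⟨p, hp⟩ := Finset.card_pos.mp hpos
    obtain ⟨hp, hw⟩ := Finset.mem_filter.mp hp
    rw [← hammingNorm_puncturedTraceWord hp] at hw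
    refine ⟨_, (hmem _).mpr ⟨p, hp, rfl⟩, 0, Submodule.zero_mem _, ?_, ?_⟩
    · intro h
      rw [h, hammingNorm_zero] at hw
      omega
    · rw [hammingDist_zero_right, hw]
  · rintro r ⟨u, hu, v, hv, huv, rfl⟩
    obtain ⟨p, hp, hpu⟩ := (hmem _).mp (Submodule.sub_mem _ hv hu)
    have hp0 : p ≠ 0 := by
      rintro rfl
      rw [map_zero] at hpu
      exact huv (sub_eq_zero.mp hpu.symm).symm
    rw [hammingDist_eq_hammingNorm, neg_add_eq_sub, ← hpu,
      hammingNorm_puncturedTraceWord hp]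
    have hle := Nat.sub_le (2 ^ (2 * j + 4)) (2 ^ (j + 2))
    rcases hammingNorm_gold hF hme hne hp hp0 with h | h | h
    · exact h.ge
    · exact hle.trans h.ge
    · exact hle.trans ((Nat.le_add_right _ _).trans h.ge)

end ShortenedGold

theorem mainTheorem1 {F : Type*} [Field F] [Fintype F] [DecidableEq F] [Algebra (ZMod 2) F]
    (m e : ℕ) (hm5 : 5 ≤ m) (hmodd : Odd m) (he : 0 < e) (hme : Nat.gcd m e = 1)
    (hF : Fintype.card F = 2 ^ m) (T : Finset F) (hT : T.card = 4) :
    IsLinearCode (shortenedCode (traceCode 2 F (fun x => x ^ (2 ^ e + 1))) T)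
      (2 ^ m - 4) (2 * m - 3) (2 ^ (m - 1) - 2 ^ ((m - 1) / 2)) ∧
    (((∑ x ∈ T, x) ≠ 0 ∧
        Algebra.trace (ZMod 2) F
          ((∑ x ∈ T, x ^ (2 ^ e + 1)) / (∑ x ∈ T, x) ^ (2 ^ e + 1)) = 1) →
      ∀ w : ℕ, (weightCount (shortenedCode (traceCode 2 F (fun x => x ^ (2 ^ e + 1))) T) w : ℚ) =
        weightTableB m w) ∧
    (¬ ((∑ x ∈ T, x) ≠ 0 ∧
        Algebra.trace (ZMod 2) F
          ((∑ x ∈ T, x ^ (2 ^ e + 1)) / (∑ x ∈ T, x) ^ (2 ^ e + 1)) = 1) →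
      ∀ w : ℕ, (weightCount (shortenedCode (traceCode 2 F (fun x => x ^ (2 ^ e + 1))) T) w : ℚ) =
        weightTableA m w) := by
  have hne : T.Nonempty := Finset.card_pos.mp (by omega)
  have hpair := goldPairCount_four hF hme hmodd hT
  -- Writing `m = 2j + 5` makes every truncated subtraction and division in the exponents explicit.
  obtain ⟨j, rfl⟩ : ∃ j, m = 2 * j + 5 := by
    obtain ⟨k, rfl⟩ := hmodd
    exact ⟨k - 2, by omega⟩
  have x1 : 2 * j + 5 - 1 = 2 * j + 4 := by omega
  have x2 : (2 * j + 4) / 2 = j + 2 := by omega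
  have x3 : (2 * j + 5 - 3) / 2 = j + 1 := by omega
  have x4 : 2 * j + 5 - 3 = 2 * j + 2 := by omega
  have x5 : 2 * (2 * j + 5) - 5 = 4 * j + 5 := by omega
  have x6 : (3 * (2 * j + 5) - 5) / 2 = 3 * j + 5 := by omega
  have x7 : 2 * j + 5 - 4 = 2 * j + 1 := by omega
  have x8 : 2 * j + 5 - 2 = 2 * j + 3 := by omega
  obtain ⟨q1, q2, q3⟩ := goldWeightCount_equations hF hme hT
  have q0 := goldWeightCount_zero hF hme hne
  have hcount (w : ℕ) := weightCount_shortenedCode_gold hF hme hne w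
  have hrest (w : ℕ) := goldWeightCount_eq_zero (w := w) hF hme hne
  refine ⟨⟨?_, ?_, ?_⟩, fun hB w => ?_, fun hA w => ?_⟩
  · rw [Fintype.card_subtype_compl, hF, Fintype.card_coe, hT]
  · rw [finrank_shortenedCode_gold hF hme hT]
    omega
  · rw [x1, x2]
    exact minDist_shortenedCode_gold hF hme hT
  · rw [if_pos hB] at hpair
    rw [hpair] at q1 q2 q3
    rw [hcount, weightTableB, x1, x2, x3, x5, x6, x7]
    split_ifs with h0 h1 h2 h3
    · rw [h0, q0, Nat.cast_one]
    · rw [h1, q1]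
      push_cast
      ring
    · rw [h2, q2]
      push_cast
      ring
    · rw [h3, q3]
      push_cast
      ring
    · rw [hrest w h0 h1 h2 h3, Nat.cast_zero]
  · rw [if_neg hA] at hpair
    rw [hpair] at q1 q2 q3
    rw [hcount, weightTableA, x1, x2, x3, x4, x5, x6, x8]
    split_ifs with h0 h1 h2 h3
    · rw [h0, q0, Nat.cast_one]
    · rw [h1, q1]
      push_cast
      ring
    · rw [h2, q2, show (4 : ℚ) = 2 ^ 2 by norm_num, ← pow_mul]
      push_cast
      ring
    · rw [h3, q3]
      push_cast
      ring
    · rw [hrest w h0 h1 h2 h3, Nat.cast_zero]
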